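/- Let $\mathbb{D}=\{z\in\mathbb{C}:|z|<1\}$ be equipped with the Poincaré distance \[ \omega(z,w)=\tanh^{-1}\left|\frac{z-w}{1-\bar w z}\right|,\qquad z,w\in\mathbb{D}. \] For a domain $D\subset\mathbb{C}$ and $p,q\in D$, the Kobayashi pseudodistance $d_D(p,q)$ is the infimum of the sums $\sum_{i=1}^k\omega(a_i,b_i)$ over all $k\ge 1$, all points $p=p_0,p_1,\dots,p_k=q$ of $D$, all $a_1,\dots,a_k,b_1,\dots,b_k\in\mathbb{D}$ and all holomorphic maps $f_1,\dots,f_k:\mathbb{D}\to D$ such that $f_i(a_i)=p_{i-1}$ and $f_i(b_i)=p_i$ for $i=1,\dots,k$. The domain $D$ is called complete Kobayashi hyperbolic if $d_D$ is a genuine distance on $D$ and the metric space $(D,d_D)$ is complete. Theorem. The twice-punctured plane $\mathbb{C}\setminus\{0,1\}$ is complete Kobayashi hyperbolic. -/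

import Mathlib

open Set Metric

noncomputable section

/-- The Poincaré distance `ω(z, w) = (1/2) log ((1 + t) / (1 - t)) = artanh t`, with
`t = |(z - w) / (1 - conj w * z)|`, used for `z, w` in the open unit disk. -/
def poincareDist (z w : ℂ) : ℝ :=
  (1 / 2) * Real.log
    ((1 + ‖(z - w) / (1 - (starRingEnd ℂ) w * z)‖) / (1 - ‖(z - w) / (1 - (starRingEnd ℂ) w * z)‖))

/-- The lengths of all finite chains of holomorphic disks in the planar domain `D` from `p` to `q`:
points `p = x 0, …, x k = q`, points `a i, b i` of the open unit disk, and holomorphic maps `f i`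
from the open unit disk into `D` with `f i (a i) = x i` and `f i (b i) = x (i + 1)` for `i < k`;
the length of such a chain is the sum of the `ω(a i, b i)`. -/
def kobayashiChainLengths (D : Set ℂ) (p q : ℂ) : Set ℝ :=
  {s : ℝ | ∃ (k : ℕ) (x a b : ℕ → ℂ) (f : ℕ → ℂ → ℂ),
    0 < k ∧ x 0 = p ∧ x k = q ∧
    (∀ i < k, a i ∈ ball (0 : ℂ) 1 ∧ b i ∈ ball (0 : ℂ) 1 ∧
      DifferentiableOn ℂ (f i) (ball (0 : ℂ) 1) ∧ MapsTo (f i) (ball (0 : ℂ) 1) D ∧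
      f i (a i) = x i ∧ f i (b i) = x (i + 1)) ∧
    s = ∑ i ∈ Finset.range k, poincareDist (a i) (b i)}

/-- The Kobayashi pseudodistance of the planar domain `D`: the infimum of the lengths of all chains
of holomorphic disks from `p` to `q` (taken in `[0, ∞]`, so that it is `∞` if there is none). -/
def kobayashiDist (D : Set ℂ) (p q : ℂ) : ENNReal :=
  ⨅ s ∈ kobayashiChainLengths D p q, ENNReal.ofReal s

/-- `D` is complete Kobayashi hyperbolic: its Kobayashi pseudodistance is a genuine (finite)
distance on `D`, and `D` with this distance is a complete metric space. The uniform structure is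
the one of the Kobayashi distance, not the one induced from `ℂ`. -/
def IsCompleteKobayashiHyperbolic (D : Set ℂ) : Prop :=
  ∃ m : MetricSpace D,
    (∀ p q : D, kobayashiDist D (p : ℂ) (q : ℂ) = ENNReal.ofReal (@dist D m.toDist p q)) ∧
    @CompleteSpace D m.toPseudoMetricSpace.toUniformSpace

end

/-! Let h(w) be 4 + |log|w||/π plus the same expression at 1 - w; it blows up exactly at 0, 1 and ∞.
The theorem rests on log h being Lipschitz along short chains of disks
(`punctureHeight_le_and_norm_sub_le_of_mem_kobayashiChainLengths`). A small Kobayashi ball then lies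
in a compact set on which h is bounded, so a Cauchy sequence has a Euclidean limit point in the
domain. Small affine disks show that Euclidean convergence implies Kobayashi convergence. The height
bound also confines short disks to bounded sets, and the Schwarz lemma then separates points.

The Lipschitz bound is a multiplicative form of Schottky's theorem (`four_add_abs_log_norm_le`). A
map f of the disk omitting 0 and 1 is exp(2πi cosh² g), where g omits a 4-dense set; Bloch's theorem
therefore bounds g'. Since |log|f||/π = |Im cosh 2g|, a bounded move of g multiplies 4 + |log|f||/π
by a bounded factor. Iterating this factor along chains is what puts the punctures at infinite
distance. -/

/-! ### Holomorphic logarithms and Bloch's theorem -/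

/-- A holomorphic function without zeros on a disk has a holomorphic logarithm there. -/
theorem exists_log_of_ne_zero {c : ℂ} {r : ℝ} (hr : 0 < r) {f : ℂ → ℂ}
    (hf : DifferentiableOn ℂ f (ball c r)) (h0 : ∀ z ∈ ball c r, f z ≠ 0) :
    ∃ g : ℂ → ℂ, DifferentiableOn ℂ g (ball c r) ∧ g c = Complex.log (f c) ∧
      ∀ z ∈ ball c r, Complex.exp (g z) = f z := by
  have hd : DifferentiableOn ℂ (fun z => deriv f z / f z) (ball c r) :=
    (hf.deriv isOpen_ball).div hf h0
  obtain ⟨g, hgc, hg⟩ := hd.isExactOn_ball.with_val_at c (Complex.log (f c))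
  have hc : c ∈ ball c r := mem_ball_self hr
  refine ⟨g, fun z hz => (hg z hz).differentiableAt.differentiableWithinAt, hgc, fun z hz => ?_⟩
  have key : ∀ z ∈ ball c r, HasDerivAt (fun z => f z * Complex.exp (-g z)) 0 z := by
    intro z hz
    have h1 : HasDerivAt f (deriv f z) z :=
      (hf.differentiableAt (isOpen_ball.mem_nhds hz)).hasDerivAt
    have h2 := h1.mul (hg z hz).neg.cexp
    refine h2.congr_deriv ?_
    have := h0 z hz
    field_simp
    ring
  have hconst : f z * Complex.exp (-g z) = f c * Complex.exp (-g c) :=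
    isOpen_ball.is_const_of_deriv_eq_zero (convex_ball c r).isPreconnected
      (fun z hz => (key z hz).differentiableAt.differentiableWithinAt)
      (fun z hz => (key z hz).deriv) hz hc
  rw [hgc, Complex.exp_neg, Complex.exp_neg, Complex.exp_log (h0 c hc),
    mul_inv_cancel₀ (h0 c hc)] at hconst
  exact (eq_of_div_eq_one (by rw [div_eq_mul_inv]; exact hconst)).symm

/-- If `f'` is at most twice `|f' z|` on a disk of radius `ρ` around `z`, then the image of that
disk contains a disk of radius `|f' z| ρ / 32`. -/
theorem ball_subset_image_of_norm_deriv_le {f : ℂ → ℂ} {z : ℂ} {ρ : ℝ} (hρ : 0 < ρ)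
    (hf : DifferentiableOn ℂ f (ball z ρ)) (h0 : deriv f z ≠ 0)
    (hb : ∀ w ∈ ball z ρ, ‖deriv f w‖ ≤ 2 * ‖deriv f z‖) :
    ball (f z) (‖deriv f z‖ * ρ / 32) ⊆ f '' ball z ρ := by
  set A := ‖deriv f z‖ with hA
  have hApos : 0 < A := norm_pos_iff.2 h0
  have hsub : closedBall z (ρ / 8) ⊆ ball z ρ := closedBall_subset_ball (by linarith)
  -- Schwarz lemma for f': it varies by at most 4A on the disk of radius ρ, hence by A/2 on radius
  -- ρ/8.
  have hd : ∀ w ∈ closedBall z (ρ / 8), ‖deriv f w - deriv f z‖ ≤ A / 2 := by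
    intro w hw
    have h1 : MapsTo (deriv f) (ball z ρ) (closedBall (deriv f z) (4 * A)) := by
      intro x hx
      rw [mem_closedBall, dist_eq_norm]
      have := norm_sub_le (deriv f x) (deriv f z)
      linarith [hb x hx]
    have h2 := Complex.dist_le_div_mul_dist_of_mapsTo_ball (hf.deriv isOpen_ball) h1 (hsub hw)
    rw [dist_eq_norm] at h2
    refine h2.trans ?_
    calc 4 * A / ρ * dist w z ≤ 4 * A / ρ * (ρ / 8) := by gcongr; exact hw
      _ = A / 2 := by field_simp; norm_num
  -- f minus its linear part is A/2-Lipschitz, so |f w - f z| ≥ Aρ/8 - Aρ/16. The quantitative open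
  -- mapping theorem below halves this.
  have hlow : ∀ w ∈ sphere z (ρ / 8), A * ρ / 16 ≤ ‖f w - f z‖ := by
    intro w hw
    have hw' : w ∈ closedBall z (ρ / 8) := sphere_subset_closedBall hw
    have hmv := (convex_closedBall z (ρ / 8)).norm_image_sub_le_of_norm_hasDerivWithin_le
      (f := fun x => f x - deriv f z * x) (f' := fun x => deriv f x - deriv f z) (C := A / 2)
      (fun x hx => by
        have h1 : HasDerivAt f (deriv f x) x :=
          (hf.differentiableAt (isOpen_ball.mem_nhds (hsub hx))).hasDerivAt
        have h2 := h1.sub ((hasDerivAt_id x).const_mul (deriv f z))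
        simp only [mul_one] at h2
        exact h2.hasDerivWithinAt) hd (mem_closedBall_self (by positivity)) hw'
    have hwz : ‖w - z‖ = ρ / 8 := by rw [← dist_eq_norm]; exact hw
    rw [hwz] at hmv
    have e : deriv f z * (w - z) =
        (f w - f z) - ((f w - deriv f z * w) - (f z - deriv f z * z)) := by ring
    have h3 : ‖deriv f z * (w - z)‖ = A * (ρ / 8) := by rw [norm_mul, hwz]
    have h4 := norm_sub_le (f w - f z) ((f w - deriv f z * w) - (f z - deriv f z * z))
    rw [← e, h3] at h4
    linarith
  have hdc : DiffContOnCl ℂ f (ball z (ρ / 8)) := (hf.mono hsub).diffContOnCl_ball subset_rfl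
  have hfreq : ∃ᶠ w in nhds z, f w ≠ f z := by
    intro hcon
    have : f =ᶠ[nhds z] fun _ => f z := hcon.mono fun w hw => not_not.1 hw
    exact h0 (by rw [this.deriv_eq]; simp)
  have := hdc.ball_subset_image_closedBall (by positivity) hlow hfreq
  rw [show A * ρ / 32 = A * ρ / 16 / 2 by ring]
  exact this.trans (image_mono hsub)

/-- **Bloch's theorem** (with a non-optimal constant). -/
theorem norm_deriv_mul_le_of_forall_not_ball_subset {f : ℂ → ℂ} {c : ℂ} {r s : ℝ} (hr : 0 < r)
    (hf : DifferentiableOn ℂ f (ball c r)) (himg : ∀ w, ¬ ball w s ⊆ f '' ball c r) :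
    ‖deriv f c‖ * r ≤ 128 * s := by
  set r' := r / 2 with hr'
  have hr'0 : 0 < r' := by positivity
  have hsub : closedBall c r' ⊆ ball c r := closedBall_subset_ball (by linarith)
  -- At a maximum point z of this weight, |f'| at most doubles on the disk of radius half the
  -- distance from z to the circle of radius r'. The closed disk of radius r/2 makes the maximum
  -- exist.
  have hcont : ContinuousOn (fun z => (r' - dist z c) * ‖deriv f z‖) (closedBall c r') := by
    have h1 := ((hf.deriv isOpen_ball).continuousOn.mono hsub).norm
    exact (by fun_prop : Continuous fun z : ℂ => r' - dist z c).continuousOn.mul h1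
  obtain ⟨z, hz, hmax⟩ := (isCompact_closedBall c r').exists_isMaxOn
    ⟨c, mem_closedBall_self hr'0.le⟩ hcont
  have hmax' : ∀ w ∈ closedBall c r',
      (r' - dist w c) * ‖deriv f w‖ ≤ (r' - dist z c) * ‖deriv f z‖ := fun w hw => hmax hw
  have hc := hmax' c (mem_closedBall_self hr'0.le)
  rw [dist_self, sub_zero] at hc
  by_contra hlt
  push Not at hlt
  have hs : 0 ≤ s := by
    by_contra hs
    exact himg c (by rw [ball_eq_empty.2 (not_le.1 hs).le]; exact empty_subset _)
  have hm : 64 * s < (r' - dist z c) * ‖deriv f z‖ := by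
    have : r' * ‖deriv f c‖ = ‖deriv f c‖ * r / 2 := by rw [hr']; ring
    linarith
  have hz' : dist z c ≤ r' := hz
  have hρ : 0 < r' - dist z c := by
    refine lt_of_le_of_ne (by linarith) fun h => ?_
    rw [← h, zero_mul] at hm
    linarith
  have hA : deriv f z ≠ 0 := by
    intro h
    rw [h, norm_zero, mul_zero] at hm
    linarith
  set ρ := (r' - dist z c) / 2 with hρdef
  have hρ0 : 0 < ρ := by positivity
  have hball : ball z ρ ⊆ closedBall c r' := by
    intro w hw
    rw [mem_ball] at hw
    rw [mem_closedBall]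
    linarith [dist_triangle w z c]
  have hbound : ∀ w ∈ ball z ρ, ‖deriv f w‖ ≤ 2 * ‖deriv f z‖ := by
    intro w hw
    have h1 := hmax' w (hball hw)
    rw [mem_ball] at hw
    have h2 : ρ ≤ r' - dist w c := by linarith [dist_triangle w z c]
    have h3 : ρ * ‖deriv f w‖ ≤ ρ * (2 * ‖deriv f z‖) := by
      calc ρ * ‖deriv f w‖ ≤ (r' - dist w c) * ‖deriv f w‖ := by gcongr
        _ ≤ (r' - dist z c) * ‖deriv f z‖ := h1
        _ = ρ * (2 * ‖deriv f z‖) := by rw [hρdef]; ring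
    exact le_of_mul_le_mul_left h3 hρ0
  refine himg (f z) (Subset.trans (ball_subset_ball ?_)
    ((ball_subset_image_of_norm_deriv_le hρ0 (hf.mono (hball.trans hsub)) hA hbound).trans
      (image_mono (hball.trans hsub))))
  rw [hρdef]
  linarith

/-! ### Landau's representation and Schottky's theorem -/

/-- Every nonnegative real is within distance one of a real number whose `cosh` squared is an
integer. -/
theorem exists_cosh_sq_eq_nat {x : ℝ} (hx : 0 ≤ x) :
    ∃ a : ℝ, |a - x| ≤ 1 ∧ ∃ n : ℕ, Real.cosh a ^ 2 = n := by
  have hc1 : 1 ≤ Real.sinh 1 := Real.self_le_sinh_iff.2 zero_le_one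
  have hgap : Real.cosh x ^ 2 + 1 ≤ Real.cosh (x + 1) ^ 2 := by
    rw [Real.cosh_add]
    have h1 := Real.one_le_cosh x
    have h2 := Real.one_le_cosh 1
    have h3 : 0 ≤ Real.sinh x := Real.sinh_nonneg_iff.2 hx
    have h4 := Real.cosh_sq 1
    have h5 : 0 ≤ Real.sinh x * Real.sinh 1 := by positivity
    have h6 : Real.cosh x * Real.cosh 1 ≤ Real.cosh x * Real.cosh 1 + Real.sinh x * Real.sinh 1 := by
      linarith
    have h7 : (Real.cosh x * Real.cosh 1) ^ 2 ≤
        (Real.cosh x * Real.cosh 1 + Real.sinh x * Real.sinh 1) ^ 2 := by gcongr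
    have h8 : 1 * 1 ≤ Real.cosh x ^ 2 * Real.sinh 1 ^ 2 := by
      gcongr
      · exact one_le_pow₀ h1
      · exact one_le_pow₀ hc1
    rw [mul_pow, h4] at h7
    linarith
  have hn1 := Nat.le_ceil (Real.cosh x ^ 2)
  have hn2 := Nat.ceil_lt_add_one (sq_nonneg (Real.cosh x))
  obtain ⟨a, ha, hav⟩ := intermediate_value_Icc (by linarith : x ≤ x + 1)
    ((Real.continuous_cosh.pow 2).continuousOn (s := Icc x (x + 1)))
    (show ((⌈Real.cosh x ^ 2⌉₊ : ℕ) : ℝ) ∈ Icc _ _ from ⟨hn1, by simp only [Pi.pow_apply]; linarith⟩)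
  exact ⟨a, abs_le.2 ⟨by linarith [ha.1], by linarith [ha.2]⟩, _, hav⟩

/-- The points where `cosh` squared is an integer are `4`-dense in the plane. -/
theorem exists_mem_ball_cosh_sq_eq_nat (w : ℂ) :
    ∃ v ∈ ball w 4, ∃ n : ℕ, Complex.cosh v ^ 2 = n := by
  obtain ⟨a, ha, n, hn⟩ : ∃ a : ℝ, |a - w.re| ≤ 1 ∧ ∃ n : ℕ, Real.cosh a ^ 2 = n := by
    rcases le_total 0 w.re with h | h
    · exact exists_cosh_sq_eq_nat h
    · obtain ⟨a, ha, n, hn⟩ := exists_cosh_sq_eq_nat (neg_nonneg.2 h)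
      refine ⟨-a, ?_, n, by rwa [Real.cosh_neg]⟩
      rw [← abs_neg]
      convert ha using 2
      ring
  obtain ⟨m, hm⟩ : ∃ m : ℤ, |m * Real.pi - w.im| ≤ 2 := by
    refine ⟨round (w.im / Real.pi), ?_⟩
    have h1 := abs_sub_round (w.im / Real.pi)
    have h2 : |round (w.im / Real.pi) * Real.pi - w.im| =
        |w.im / Real.pi - round (w.im / Real.pi)| * Real.pi := by
      rw [← abs_neg, ← abs_of_pos Real.pi_pos, ← abs_mul, abs_of_pos Real.pi_pos]
      congr 1
      field_simp
      ring
    rw [h2]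
    nlinarith [Real.pi_le_four, Real.pi_pos]
  refine ⟨a + m * Real.pi * Complex.I, ?_, n, ?_⟩
  · rw [mem_ball, dist_eq_norm]
    have := Complex.norm_le_abs_re_add_abs_im (a + m * Real.pi * Complex.I - w)
    simp at this
    linarith
  · rw [Complex.cosh_add, Complex.cosh_mul_I, Complex.sinh_mul_I]
    have hs : Complex.sin (m * Real.pi) = 0 := Complex.sin_int_mul_pi m
    have hcs : Complex.cos (m * Real.pi) ^ 2 = 1 := by
      have := Complex.sin_sq_add_cos_sq (m * Real.pi)
      rw [hs] at this
      simpa using this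
    rw [hs, zero_mul, mul_zero, add_zero, mul_pow, hcs, mul_one]
    exact_mod_cast hn

/-- **Landau's representation** of holomorphic functions on the unit disk omitting `0` and `1`. -/
theorem exists_eq_exp_cosh_sq {f : ℂ → ℂ} (hf : DifferentiableOn ℂ f (ball 0 1))
    (hm : MapsTo f (ball 0 1) ({0, 1}ᶜ : Set ℂ)) :
    ∃ g : ℂ → ℂ, DifferentiableOn ℂ g (ball 0 1) ∧ |(Complex.cosh (g 0) ^ 2).re| ≤ 1 ∧
      ∀ z ∈ ball (0 : ℂ) 1,
        f z = Complex.exp (Complex.cosh (g z) ^ 2 * (2 * Real.pi * Complex.I)) := by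
  have hne : ∀ z ∈ ball (0 : ℂ) 1, f z ≠ 0 ∧ f z ≠ 1 := fun z hz => by simpa using hm hz
  have hpi : (2 * Real.pi * Complex.I : ℂ) ≠ 0 := Complex.two_pi_I_ne_zero
  obtain ⟨l, hl, hl0, hle⟩ := exists_log_of_ne_zero one_pos hf fun z hz => (hne z hz).1
  set h : ℂ → ℂ := fun z => l z / (2 * Real.pi * Complex.I) with hh
  have hhd : DifferentiableOn ℂ h (ball 0 1) := hl.div_const _
  have hfh : ∀ z ∈ ball (0 : ℂ) 1, f z = Complex.exp (h z * (2 * Real.pi * Complex.I)) := by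
    intro z hz
    rw [hh, div_mul_cancel₀ _ hpi, hle z hz]
  have hint : ∀ z ∈ ball (0 : ℂ) 1, ∀ n : ℤ, h z ≠ n := by
    intro z hz n hn
    refine (hne z hz).2 ?_
    rw [hfh z hz, hn]
    exact Complex.exp_eq_one_iff.2 ⟨n, rfl⟩
  -- Since h omits 0 and 1, both h and h - 1 have holomorphic square roots A and B. From A² - B² =
  -- 1, A + B has no zeros, and its logarithm g has cosh g = A.
  obtain ⟨α, hα, -, hαe⟩ := exists_log_of_ne_zero one_pos hhd
    fun z hz => by simpa using hint z hz 0
  obtain ⟨β, hβ, -, hβe⟩ := exists_log_of_ne_zero one_pos (hhd.sub_const 1)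
    fun z hz => sub_ne_zero.2 (by simpa using hint z hz 1)
  set A : ℂ → ℂ := fun z => Complex.exp (α z / 2) with hA
  set B : ℂ → ℂ := fun z => Complex.exp (β z / 2) with hB
  have hA2 : ∀ z ∈ ball (0 : ℂ) 1, A z ^ 2 = h z := by
    intro z hz
    rw [hA, ← hαe z hz, ← Complex.exp_nat_mul]
    congr 1
    push_cast
    ring
  have hB2 : ∀ z ∈ ball (0 : ℂ) 1, B z ^ 2 = h z - 1 := by
    intro z hz
    rw [hB, ← hβe z hz, ← Complex.exp_nat_mul]
    congr 1
    push_cast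
    ring
  have hAB : ∀ z ∈ ball (0 : ℂ) 1, (A z + B z) * (A z - B z) = 1 := by
    intro z hz
    linear_combination hA2 z hz - hB2 z hz
  obtain ⟨g, hg, -, hge⟩ := exists_log_of_ne_zero one_pos
    ((hα.div_const 2).cexp.add (hβ.div_const 2).cexp) fun z hz => left_ne_zero_of_mul_eq_one (hAB z hz)
  have hcosh : ∀ z ∈ ball (0 : ℂ) 1, Complex.cosh (g z) ^ 2 = h z := by
    intro z hz
    have h1 : Complex.exp (g z) = A z + B z := hge z hz
    have h2 : Complex.exp (-g z) = A z - B z := by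
      rw [Complex.exp_neg, h1]
      exact inv_eq_of_mul_eq_one_right (hAB z hz)
    rw [Complex.cosh, h1, h2, ← hA2 z hz]
    ring
  refine ⟨g, hg, ?_, fun z hz => by rw [hcosh z hz]; exact hfh z hz⟩
  rw [hcosh 0 (mem_ball_self one_pos)]
  -- The principal logarithm was chosen at the centre to remove the integer ambiguity in h: it
  -- bounds Re h(0).
  have hre : (h 0).re = (f 0).arg / (2 * Real.pi) := by
    have : h 0 = ((f 0).arg / (2 * Real.pi) : ℝ) +
        (-(Real.log ‖f 0‖ / (2 * Real.pi)) : ℝ) * Complex.I := by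
      rw [hh]
      simp only
      rw [hl0, Complex.log, div_eq_iff hpi]
      push_cast
      have : (Real.pi : ℂ) ≠ 0 := by exact_mod_cast Real.pi_ne_zero
      field_simp
      linear_combination (Real.log ‖f 0‖ : ℂ) * Complex.I_sq
    rw [this, Complex.add_re, Complex.ofReal_re, Complex.re_ofReal_mul, Complex.I_re, mul_zero,
      add_zero]
  rw [hre, abs_div, abs_of_pos Real.two_pi_pos, div_le_one Real.two_pi_pos]
  linarith [Complex.abs_arg_le_pi (f 0), Real.pi_pos]

theorem norm_sinh_le (z : ℂ) : ‖Complex.sinh z‖ ≤ Real.sinh ‖z‖ := by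
  refine (Complex.hasSum_sinh z).norm_le_of_bounded (Real.hasSum_sinh ‖z‖) fun n => ?_
  simp

theorem norm_cosh_sub_one_le (z : ℂ) : ‖Complex.cosh z - 1‖ ≤ Real.cosh ‖z‖ - 1 := by
  have h1 : Complex.cosh z - 1 = 2 * Complex.sinh (z / 2) ^ 2 := by
    have := Complex.cosh_two_mul (z / 2)
    rw [mul_div_cancel₀ _ two_ne_zero, Complex.cosh_sq] at this
    linear_combination this
  have h2 : Real.cosh ‖z‖ - 1 = 2 * Real.sinh ‖z / 2‖ ^ 2 := by
    have := Real.cosh_two_mul (‖z‖ / 2)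
    rw [mul_div_cancel₀ _ two_ne_zero, Real.cosh_sq] at this
    rw [norm_div, Complex.norm_ofNat]
    linear_combination this
  rw [h1, h2, norm_mul, norm_pow, Complex.norm_ofNat]
  gcongr
  exact norm_sinh_le _

theorem norm_sinh_le_norm_cosh_add_one (z : ℂ) :
    ‖Complex.sinh z‖ ≤ ‖Complex.cosh z‖ + 1 := by
  refine (sq_le_sq₀ (norm_nonneg _) (by positivity)).1 ?_
  rw [← norm_pow, Complex.sinh_sq]
  have h := norm_sub_le (Complex.cosh z ^ 2) 1
  rw [norm_pow, norm_one] at h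
  nlinarith [norm_nonneg (Complex.cosh z)]

/-- By the addition formula, using |sinh a| ≤ |cosh a| + 1. The bound is relative to the size of
cosh a, which makes Schottky's estimate multiplicative. -/
theorem norm_cosh_add_sub_cosh_le (a b : ℂ) :
    ‖Complex.cosh (a + b) - Complex.cosh a‖ ≤ (‖Complex.cosh a‖ + 1) * (Real.exp ‖b‖ - 1) := by
  have e : Complex.cosh (a + b) - Complex.cosh a =
      Complex.cosh a * (Complex.cosh b - 1) + Complex.sinh a * Complex.sinh b := by
    rw [Complex.cosh_add]
    ring
  rw [e, ← Real.cosh_add_sinh]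
  have h1 := norm_cosh_sub_one_le b
  calc _ ≤ ‖Complex.cosh a‖ * ‖Complex.cosh b - 1‖ + ‖Complex.sinh a‖ * ‖Complex.sinh b‖ := by
        rw [← norm_mul, ← norm_mul]
        exact norm_add_le _ _
    _ ≤ (‖Complex.cosh a‖ + 1) * (Real.cosh ‖b‖ - 1) +
        (‖Complex.cosh a‖ + 1) * Real.sinh ‖b‖ := by
        gcongr
        · linarith
        · exact norm_sinh_le_norm_cosh_add_one a
        · exact norm_sinh_le b
    _ = _ := by ring

/-- **Schottky's theorem**, with the growth rate that makes punctures infinitely distant. -/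
theorem four_add_abs_log_norm_le {f : ℂ → ℂ} (hf : DifferentiableOn ℂ f (ball 0 1))
    (hm : MapsTo f (ball 0 1) ({0, 1}ᶜ : Set ℂ)) {z : ℂ} (hz : ‖z‖ ≤ 1 / 2) :
    4 + |Real.log ‖f z‖| / Real.pi ≤
      (4 + |Real.log ‖f 0‖| / Real.pi) * Real.exp (2048 * ‖z‖) := by
  obtain ⟨g, hg, hg0, hfg⟩ := exists_eq_exp_cosh_sq hf hm
  have himg : ∀ w, ¬ ball w 4 ⊆ g '' ball 0 1 := by
    intro w hw
    obtain ⟨v, hv, n, hn⟩ := exists_mem_ball_cosh_sq_eq_nat w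
    obtain ⟨x, hx, rfl⟩ := hw hv
    have h1 : f x = 1 := by
      rw [hfg x hx, hn]
      exact Complex.exp_eq_one_iff.2 ⟨n, by simp⟩
    have := hm hx
    simp [h1] at this
  -- Bloch on disks of radius 1/2, with omitted radius 4: 128 · 4 / (1/2) = 1024.
  have hd : ∀ x ∈ closedBall (0 : ℂ) (1 / 2), ‖deriv g x‖ ≤ 1024 := by
    intro x hx
    have hsub : ball x (1 / 2) ⊆ ball 0 1 := by
      refine ball_subset_ball' ?_
      rw [mem_closedBall] at hx
      linarith
    have := norm_deriv_mul_le_of_forall_not_ball_subset (by norm_num) (hg.mono hsub)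
      fun w hw => himg w (hw.trans (image_mono hsub))
    linarith
  have hgz : ‖g z - g 0‖ ≤ 1024 * ‖z - 0‖ :=
    (convex_closedBall (0 : ℂ) (1 / 2)).norm_image_sub_le_of_norm_deriv_le
      (fun x hx => hg.differentiableAt (isOpen_ball.mem_nhds
        (closedBall_subset_ball (by norm_num) hx))) hd (mem_closedBall_self (by norm_num))
      (mem_closedBall_zero_iff.2 hz)
  rw [sub_zero] at hgz
  have hlog : ∀ x ∈ ball (0 : ℂ) 1,
      |Real.log ‖f x‖| / Real.pi = |(Complex.cosh (2 * g x)).im| := by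
    intro x hx
    have e : Complex.cosh (g x) ^ 2 * (2 * Real.pi * Complex.I) =
        (Real.pi : ℝ) * ((Complex.cosh (2 * g x) + 1) * Complex.I) := by
      rw [Complex.cosh_two_mul, Complex.sinh_sq]
      ring
    rw [hfg x hx, Complex.norm_exp, Real.log_exp, e, Complex.re_ofReal_mul, abs_mul,
      abs_of_pos Real.pi_pos, mul_div_cancel_left₀ _ Real.pi_ne_zero]
    simp
  rw [hlog z (mem_ball_zero_iff.2 (by linarith)), hlog 0 (mem_ball_self one_pos)]
  set H := Complex.cosh (2 * g z)
  set H₀ := Complex.cosh (2 * g 0) with hH₀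
  have hdiff : ‖H - H₀‖ ≤ (‖H₀‖ + 1) * (Real.exp (2048 * ‖z‖) - 1) := by
    have h1 := norm_cosh_add_sub_cosh_le (2 * g 0) (2 * (g z - g 0))
    rw [show 2 * g 0 + 2 * (g z - g 0) = 2 * g z by ring, norm_mul 2 (g z - g 0),
      Complex.norm_ofNat] at h1
    have h2 : 2 * ‖g z - g 0‖ ≤ 2048 * ‖z‖ := by linarith
    exact h1.trans (by gcongr)
  -- Re H₀ = 2 Re cosh²(g 0) - 1 lies in [-3, 1]; this is the origin of the constant 4.
  have hH0 : ‖H₀‖ + 1 ≤ 4 + |H₀.im| := by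
    have h1 := Complex.norm_le_abs_re_add_abs_im H₀
    have h2 : H₀.re = 2 * (Complex.cosh (g 0) ^ 2).re - 1 := by
      have : H₀ = (2 : ℝ) * Complex.cosh (g 0) ^ 2 - 1 := by
        rw [hH₀, Complex.cosh_two_mul, Complex.sinh_sq]
        push_cast
        ring
      rw [this, Complex.sub_re, Complex.re_ofReal_mul, Complex.one_re]
    have h3 : |H₀.re| ≤ 3 := by
      rw [abs_le] at hg0 ⊢
      constructor <;> linarith [hg0.1, hg0.2]
    linarith
  have him : |H.im| ≤ |H₀.im| + ‖H - H₀‖ := by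
    have h1 := Complex.abs_im_le_norm (H - H₀)
    rw [Complex.sub_im] at h1
    have h2 := abs_add_le H₀.im (H.im - H₀.im)
    rw [add_sub_cancel] at h2
    linarith
  have hexp : 0 ≤ Real.exp (2048 * ‖z‖) - 1 :=
    sub_nonneg.2 (Real.one_le_exp (by positivity))
  have := mul_le_mul_of_nonneg_right hH0 hexp
  linarith

/-! ### The Poincaré distance and recentering of disks -/

theorem one_sub_conj_mul_ne_zero {z w : ℂ} (hz : ‖z‖ < 1) (hw : ‖w‖ < 1) :
    1 - (starRingEnd ℂ) w * z ≠ 0 := by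
  intro h
  have h1 : ‖(starRingEnd ℂ) w * z‖ = 1 := by rw [← sub_eq_zero.1 h, norm_one]
  rw [norm_mul, Complex.norm_conj] at h1
  nlinarith [norm_nonneg z, norm_nonneg w]

theorem norm_sub_div_one_sub_conj_mul_lt_one {z w : ℂ} (hz : ‖z‖ < 1) (hw : ‖w‖ < 1) :
    ‖(z - w) / (1 - (starRingEnd ℂ) w * z)‖ < 1 := by
  rw [norm_div, div_lt_one (norm_pos_iff.2 (one_sub_conj_mul_ne_zero hz hw)),
    ← sq_lt_sq₀ (norm_nonneg _) (norm_nonneg _), ← Complex.normSq_eq_norm_sq,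
    ← Complex.normSq_eq_norm_sq]
  have hz' : Complex.normSq z < 1 := by
    rw [Complex.normSq_eq_norm_sq]; exact pow_lt_one₀ (norm_nonneg _) hz two_ne_zero
  have hw' : Complex.normSq w < 1 := by
    rw [Complex.normSq_eq_norm_sq]; exact pow_lt_one₀ (norm_nonneg _) hw two_ne_zero
  have := mul_pos (sub_pos.2 hz') (sub_pos.2 hw')
  simp only [Complex.normSq_apply, Complex.sub_re, Complex.sub_im, Complex.mul_re, Complex.mul_im,
    Complex.conj_re, Complex.conj_im, Complex.one_re, Complex.one_im] at this ⊢
  linarith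

theorem poincareDist_comm (z w : ℂ) : poincareDist z w = poincareDist w z := by
  have : ‖(z - w) / (1 - (starRingEnd ℂ) w * z)‖ = ‖(w - z) / (1 - (starRingEnd ℂ) z * w)‖ := by
    rw [norm_div, norm_div, norm_sub_rev]
    congr 1
    rw [← Complex.norm_conj]
    simp [mul_comm]
  rw [poincareDist, poincareDist, this]

theorem poincareDist_self (z : ℂ) : poincareDist z z = 0 := by
  simp [poincareDist]

/-- From log x ≥ 1 - 1/x at x = (1 + t)/(1 - t), which gives 2t/(1 + t) ≥ t. The factor 2 is not
optimal. -/
theorem norm_sub_div_le_two_mul_poincareDist {z w : ℂ} (hz : ‖z‖ < 1) (hw : ‖w‖ < 1) :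
    ‖(z - w) / (1 - (starRingEnd ℂ) w * z)‖ ≤ 2 * poincareDist z w := by
  have h1 := norm_sub_div_one_sub_conj_mul_lt_one hz hw
  rw [poincareDist]
  set t := ‖(z - w) / (1 - (starRingEnd ℂ) w * z)‖
  have h0 : 0 ≤ t := norm_nonneg _
  have h2 := Real.one_sub_inv_le_log_of_pos (div_pos (by linarith : 0 < 1 + t) (sub_pos.2 h1))
  have h3 : t ≤ 1 - ((1 + t) / (1 - t))⁻¹ := by
    rw [inv_div, le_sub_iff_add_le, ← le_sub_iff_add_le', div_le_iff₀ (by linarith)]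
    nlinarith
  linarith

theorem poincareDist_nonneg {z w : ℂ} (hz : ‖z‖ < 1) (hw : ‖w‖ < 1) : 0 ≤ poincareDist z w := by
  linarith [norm_sub_div_le_two_mul_poincareDist hz hw,
    norm_nonneg ((z - w) / (1 - (starRingEnd ℂ) w * z))]

theorem continuousAt_poincareDist_zero : ContinuousAt (fun z => poincareDist 0 z) 0 := by
  have e : (fun z => poincareDist 0 z) =
      fun z : ℂ => 1 / 2 * Real.log ((1 + ‖z‖) / (1 - ‖z‖)) := by
    ext z
    simp [poincareDist]
  rw [e]
  refine ContinuousAt.mul continuousAt_const (ContinuousAt.log ?_ (by simp))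
  exact ContinuousAt.div (by fun_prop) (by fun_prop) (by simp)

/-- Recentering a holomorphic map on the unit disk by a disk automorphism. -/
theorem exists_recentered {D : Set ℂ} {f : ℂ → ℂ} (hf : DifferentiableOn ℂ f (ball 0 1))
    (hm : MapsTo f (ball 0 1) D) {a b : ℂ} (ha : ‖a‖ < 1) (hb : ‖b‖ < 1) :
    ∃ (F : ℂ → ℂ) (z : ℂ), DifferentiableOn ℂ F (ball 0 1) ∧ MapsTo F (ball 0 1) D ∧
      F 0 = f a ∧ F z = f b ∧ ‖z‖ ≤ 2 * poincareDist a b := by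
  have ha' : ‖-a‖ < 1 := by rwa [norm_neg]
  set φ : ℂ → ℂ := fun z => (z - -a) / (1 - (starRingEnd ℂ) (-a) * z) with hφ
  have hφm : MapsTo φ (ball 0 1) (ball 0 1) := fun z hz => mem_ball_zero_iff.2
    (norm_sub_div_one_sub_conj_mul_lt_one (mem_ball_zero_iff.1 hz) ha')
  have hφd : DifferentiableOn ℂ φ (ball 0 1) :=
    DifferentiableOn.div (by fun_prop) (by fun_prop)
      fun z hz => one_sub_conj_mul_ne_zero (mem_ball_zero_iff.1 hz) ha'
  refine ⟨f ∘ φ, (b - a) / (1 - (starRingEnd ℂ) a * b), hf.comp hφd hφm, hm.comp hφm,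
    by simp [hφ], ?_, ?_⟩
  · have h1 := one_sub_conj_mul_ne_zero hb ha
    have h2 := one_sub_conj_mul_ne_zero ha ha
    have h3 : 1 - (starRingEnd ℂ) (-a) * ((b - a) / (1 - (starRingEnd ℂ) a * b)) =
        (1 - (starRingEnd ℂ) a * a) / (1 - (starRingEnd ℂ) a * b) := by
      rw [map_neg]
      field_simp
      ring
    have h4 : (b - a) / (1 - (starRingEnd ℂ) a * b) - -a =
        b * (1 - (starRingEnd ℂ) a * a) / (1 - (starRingEnd ℂ) a * b) := by
      rw [sub_neg_eq_add, div_add' _ _ _ h1]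
      congr 1
      ring
    have h5 : φ ((b - a) / (1 - (starRingEnd ℂ) a * b)) = b := by
      simp only [hφ]
      rw [h3, h4, div_div_div_cancel_right₀ h1, mul_div_cancel_right₀ _ h2]
    rw [Function.comp_apply, h5]
  · rw [poincareDist_comm]
    exact norm_sub_div_le_two_mul_poincareDist hb ha

/-! ### General properties of the Kobayashi pseudodistance -/

theorem nonneg_of_mem_kobayashiChainLengths {D : Set ℂ} {p q : ℂ} {s : ℝ}
    (hs : s ∈ kobayashiChainLengths D p q) : 0 ≤ s := by
  obtain ⟨k, x, a, b, f, -, -, -, h, rfl⟩ := hs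
  refine Finset.sum_nonneg fun i hi => ?_
  obtain ⟨ha, hb, -⟩ := h i (Finset.mem_range.1 hi)
  exact poincareDist_nonneg (mem_ball_zero_iff.1 ha) (mem_ball_zero_iff.1 hb)

theorem poincareDist_mem_kobayashiChainLengths {D : Set ℂ} {f : ℂ → ℂ}
    (hf : DifferentiableOn ℂ f (ball 0 1)) (hm : MapsTo f (ball 0 1) D) {a b : ℂ}
    (ha : a ∈ ball (0 : ℂ) 1) (hb : b ∈ ball (0 : ℂ) 1) :
    poincareDist a b ∈ kobayashiChainLengths D (f a) (f b) := by
  refine ⟨1, fun i => if i = 0 then f a else f b, fun _ => a, fun _ => b, fun _ => f, one_pos,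
    by simp, by simp, fun i hi => ?_, by simp⟩
  obtain rfl : i = 0 := by omega
  exact ⟨ha, hb, hf, hm, by simp, by simp⟩

theorem mem_kobayashiChainLengths_symm {D : Set ℂ} {p q : ℂ} {s : ℝ}
    (hs : s ∈ kobayashiChainLengths D p q) : s ∈ kobayashiChainLengths D q p := by
  obtain ⟨k, x, a, b, f, hk, hp, hq, h, rfl⟩ := hs
  refine ⟨k, fun i => x (k - i), fun i => b (k - 1 - i), fun i => a (k - 1 - i),
    fun i => f (k - 1 - i), hk, by simpa, by simpa, fun i hi => ?_, ?_⟩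
  · obtain ⟨h1, h2, h3, h4, h5, h6⟩ := h (k - 1 - i) (by omega)
    exact ⟨h2, h1, h3, h4, h6.trans (congrArg x (by omega)), h5.trans (congrArg x (by omega))⟩
  · rw [← Finset.sum_range_reflect]
    exact Finset.sum_congr rfl fun i _ => poincareDist_comm _ _

theorem add_mem_kobayashiChainLengths {D : Set ℂ} {p q r : ℂ} {s t : ℝ}
    (hs : s ∈ kobayashiChainLengths D p q) (ht : t ∈ kobayashiChainLengths D q r) :
    s + t ∈ kobayashiChainLengths D p r := by
  obtain ⟨k, x, a, b, f, hk, hp, hq, h, rfl⟩ := hs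
  obtain ⟨l, y, c, d, g, hl, hq', hr, h', rfl⟩ := ht
  refine ⟨k + l, fun i => if i < k then x i else y (i - k), fun i => if i < k then a i else c (i - k),
    fun i => if i < k then b i else d (i - k), fun i => if i < k then f i else g (i - k),
    by omega, by simp [hk, hp], by simp [hr], fun i hi => ?_, ?_⟩
  · by_cases hik : i < k
    · obtain ⟨h1, h2, h3, h4, h5, h6⟩ := h i hik
      simp only [if_pos hik]
      refine ⟨h1, h2, h3, h4, h5, ?_⟩
      by_cases hik' : i + 1 < k
      · rw [if_pos hik', h6]
      · obtain rfl : i + 1 = k := by omega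
        simp [h6, hq, hq']
    · obtain ⟨h1, h2, h3, h4, h5, h6⟩ := h' (i - k) (by omega)
      simp only [if_neg hik, if_neg (show ¬ i + 1 < k by omega)]
      refine ⟨h1, h2, h3, h4, h5, ?_⟩
      rw [h6]
      congr 1
      omega
  · rw [Finset.sum_range_add]
    congr 1
    · refine Finset.sum_congr rfl fun i hi => ?_
      simp [Finset.mem_range.1 hi]
    · simp

theorem kobayashiDist_self {D : Set ℂ} {p : ℂ} (hp : p ∈ D) : kobayashiDist D p p = 0 := by
  have h := poincareDist_mem_kobayashiChainLengths (f := fun _ => p) (D := D)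
    (differentiableOn_const p) (fun _ _ => hp) (mem_ball_self one_pos) (mem_ball_self one_pos)
  rw [poincareDist_self] at h
  exact le_antisymm ((iInf₂_le 0 h).trans (by simp)) zero_le

theorem kobayashiDist_comm (D : Set ℂ) (p q : ℂ) : kobayashiDist D p q = kobayashiDist D q p :=
  le_antisymm (le_iInf₂ fun s hs => iInf₂_le s (mem_kobayashiChainLengths_symm hs))
    (le_iInf₂ fun s hs => iInf₂_le s (mem_kobayashiChainLengths_symm hs))

theorem kobayashiDist_triangle (D : Set ℂ) (p q r : ℂ) :
    kobayashiDist D p r ≤ kobayashiDist D p q + kobayashiDist D q r := by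
  simp only [kobayashiDist, ENNReal.iInf_add, ENNReal.add_iInf]
  refine le_iInf₂ fun s hs => le_iInf₂ fun t ht => ?_
  exact (iInf₂_le _ (add_mem_kobayashiChainLengths ht hs)).trans ENNReal.ofReal_add_le

theorem exists_mem_kobayashiChainLengths_lt {D : Set ℂ} {p q : ℂ} {r : ℝ}
    (h : kobayashiDist D p q < ENNReal.ofReal r) : ∃ s ∈ kobayashiChainLengths D p q, s < r := by
  obtain ⟨s, hs, hsr⟩ := by simpa only [kobayashiDist, iInf_lt_iff] using h
  exact ⟨s, hs, (ENNReal.ofReal_lt_ofReal_iff_of_nonneg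
    (nonneg_of_mem_kobayashiChainLengths hs)).1 hsr⟩

/-- The affine disk z ↦ p + Rz inside D compares the distance with ω(0, (q - p)/R). -/
theorem tendsto_kobayashiDist {D : Set ℂ} (hD : IsOpen D) {p : ℂ} (hp : p ∈ D) :
    Filter.Tendsto (kobayashiDist D p) (nhds p) (nhds 0) := by
  obtain ⟨R, hR, hRD⟩ := Metric.isOpen_iff.1 hD p hp
  have hRC : (R : ℂ) ≠ 0 := by exact_mod_cast hR.ne'
  have hlim : Filter.Tendsto (fun q => ENNReal.ofReal (poincareDist 0 ((q - p) / R))) (nhds p)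
      (nhds 0) := by
    have h1 : Filter.Tendsto (fun q : ℂ => (q - p) / R) (nhds p) (nhds 0) := by
      have : ContinuousAt (fun q : ℂ => (q - p) / R) p := by fun_prop (disch := assumption)
      simpa [ContinuousAt] using this
    have h2 : Filter.Tendsto (fun z => poincareDist 0 z) (nhds 0) (nhds 0) := by
      simpa only [ContinuousAt, poincareDist_self] using continuousAt_poincareDist_zero
    simpa using ENNReal.tendsto_ofReal (h2.comp h1)
  refine tendsto_of_tendsto_of_tendsto_of_le_of_le' tendsto_const_nhds hlim
    (Filter.Eventually.of_forall fun _ => zero_le) ?_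
  filter_upwards [ball_mem_nhds p hR] with q hq
  have hm : MapsTo (fun z => p + R * z) (ball 0 1) D := by
    intro z hz
    refine hRD ?_
    rw [mem_ball_zero_iff] at hz
    rw [mem_ball, dist_eq_norm, add_sub_cancel_left, norm_mul, Complex.norm_real,
      Real.norm_of_nonneg hR.le]
    nlinarith
  have hz : (q - p) / R ∈ ball (0 : ℂ) 1 := by
    rw [mem_ball_zero_iff, norm_div, Complex.norm_real, Real.norm_of_nonneg hR.le, div_lt_one hR,
      ← dist_eq_norm]
    exact hq
  have := poincareDist_mem_kobayashiChainLengths (by fun_prop) hm (mem_ball_self one_pos) hz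
  rw [mul_zero, add_zero, mul_div_cancel₀ _ hRC, add_sub_cancel] at this
  exact iInf₂_le _ this

/-- Being at finite distance is an equivalence relation with open classes. -/
theorem kobayashiDist_lt_top {D : Set ℂ} (hD : IsOpen D) (hc : IsPreconnected D) {p q : ℂ}
    (hp : p ∈ D) (hq : q ∈ D) : kobayashiDist D p q < ⊤ := by
  refine hc.induction₂ (fun p q => kobayashiDist D p q < ⊤) (fun x hx => ?_)
    (fun x y z _ _ _ h1 h2 => (kobayashiDist_triangle D x y z).trans_lt (ENNReal.add_lt_top.2 ⟨h1, h2⟩))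
    (fun x y _ _ h => by rwa [kobayashiDist_comm]) hp hq
  exact ((tendsto_kobayashiDist hD hx).eventually_lt_const ENNReal.zero_lt_top).filter_mono
    nhdsWithin_le_nhds

/-! ### The height function along chains of disks -/

/-- A positive function on the plane punctured at `0` and `1` that tends to infinity at `0`, `1`
and `∞`. -/
noncomputable def punctureHeight (w : ℂ) : ℝ :=
  (4 + |Real.log ‖w‖| / Real.pi) + (4 + |Real.log ‖1 - w‖| / Real.pi)

theorem punctureHeight_pos (w : ℂ) : 0 < punctureHeight w := by
  have := Real.pi_pos
  rw [punctureHeight]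
  positivity

theorem abs_log_norm_le_punctureHeight (w : ℂ) :
    |Real.log ‖w‖| ≤ Real.pi * punctureHeight w := by
  have := Real.pi_pos
  have h : 0 ≤ |Real.log ‖1 - w‖| / Real.pi := by positivity
  rw [← div_le_iff₀' this, punctureHeight]
  linarith

theorem abs_log_norm_one_sub_le_punctureHeight (w : ℂ) :
    |Real.log ‖1 - w‖| ≤ Real.pi * punctureHeight w := by
  have := Real.pi_pos
  have h : 0 ≤ |Real.log ‖w‖| / Real.pi := by positivity
  rw [← div_le_iff₀' this, punctureHeight]
  linarith

theorem norm_le_exp_punctureHeight (w : ℂ) : ‖w‖ ≤ Real.exp (Real.pi * punctureHeight w) := by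
  rcases eq_or_ne w 0 with rfl | hw
  · rw [norm_zero]
    positivity
  · rw [← Real.log_le_iff_le_exp (norm_pos_iff.2 hw)]
    exact (le_abs_self _).trans (abs_log_norm_le_punctureHeight w)

theorem punctureHeight_le_of_norm_le {f : ℂ → ℂ} (hf : DifferentiableOn ℂ f (ball 0 1))
    (hm : MapsTo f (ball 0 1) ({0, 1}ᶜ : Set ℂ)) {z : ℂ} (hz : ‖z‖ ≤ 1 / 2) :
    punctureHeight (f z) ≤ punctureHeight (f 0) * Real.exp (2048 * ‖z‖) := by
  have hm' : MapsTo (fun z => 1 - f z) (ball 0 1) ({0, 1}ᶜ : Set ℂ) := by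
    intro x hx
    have := hm hx
    simp only [mem_compl_iff, mem_insert_iff, mem_singleton_iff, not_or, sub_eq_zero,
      sub_eq_self] at this ⊢
    exact ⟨Ne.symm this.2, this.1⟩
  have h1 := four_add_abs_log_norm_le hf hm hz
  have h2 := four_add_abs_log_norm_le (hf.const_sub 1) hm' hz
  rw [punctureHeight, punctureHeight, add_mul]
  exact add_le_add h1 h2

/-- The height at most a fixed bound carves out a relatively compact part of the punctured plane. -/
theorem exists_isCompact_of_punctureHeight_le (V : ℝ) :
    ∃ K : Set ℂ, IsCompact K ∧ K ⊆ ({0, 1}ᶜ : Set ℂ) ∧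
      ∀ w ∈ ({0, 1}ᶜ : Set ℂ), punctureHeight w ≤ V → w ∈ K := by
  have hpi := Real.pi_pos
  set ε := Real.exp (-(Real.pi * V)) with hε
  have hε0 : 0 < ε := Real.exp_pos _
  refine ⟨closedBall 0 (Real.exp (Real.pi * V)) ∩ {w | ε ≤ ‖w‖ ∧ ε ≤ ‖1 - w‖}, ?_, ?_, ?_⟩
  · refine (isCompact_closedBall _ _).inter_right ?_
    exact (isClosed_le continuous_const continuous_norm).inter
      (isClosed_le continuous_const (continuous_const.sub continuous_id).norm)
  · rintro w ⟨-, h1, h2⟩ h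
    rcases h with rfl | rfl
    · rw [norm_zero] at h1
      linarith
    · rw [sub_self, norm_zero] at h2
      linarith
  · intro w hw hV
    -- Needed because `Real.log 0 = 0` makes the height finite at the punctures themselves.
    have hne : w ≠ 0 ∧ w ≠ 1 := by simpa using hw
    have hle : Real.pi * punctureHeight w ≤ Real.pi * V := by gcongr
    refine ⟨?_, ?_, ?_⟩
    · rw [mem_closedBall_zero_iff]
      exact (norm_le_exp_punctureHeight w).trans (Real.exp_le_exp.2 hle)
    · rw [hε, ← Real.le_log_iff_exp_le (norm_pos_iff.2 hne.1)]
      exact (abs_le.1 ((abs_log_norm_le_punctureHeight w).trans hle)).1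
    · rw [hε, ← Real.le_log_iff_exp_le (norm_pos_iff.2 (sub_ne_zero.2 hne.2.symm))]
      exact (abs_le.1 ((abs_log_norm_one_sub_le_punctureHeight w).trans hle)).1

theorem punctureHeight_le_of_poincareDist_lt {f : ℂ → ℂ} (hf : DifferentiableOn ℂ f (ball 0 1))
    (hm : MapsTo f (ball 0 1) ({0, 1}ᶜ : Set ℂ)) {a b : ℂ} (ha : ‖a‖ < 1) (hb : ‖b‖ < 1)
    (hab : poincareDist a b < 1 / 4) :
    punctureHeight (f b) ≤ punctureHeight (f a) * Real.exp (4096 * poincareDist a b) := by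
  obtain ⟨F, z, hF, hFm, h0, hz, hzle⟩ := exists_recentered hf hm ha hb
  have h := punctureHeight_le_of_norm_le hF hFm (z := z) (by linarith)
  rw [h0, hz] at h
  refine h.trans (mul_le_mul_of_nonneg_left (Real.exp_le_exp.2 ?_) (punctureHeight_pos _).le)
  linarith

/-- The height bound keeps the half disk within radius M; the Schwarz lemma then gives 2M/(1/2) ·
|z| with |z| ≤ 2ω(a, b). -/
theorem norm_sub_le_of_poincareDist_lt {f : ℂ → ℂ} (hf : DifferentiableOn ℂ f (ball 0 1))
    (hm : MapsTo f (ball 0 1) ({0, 1}ᶜ : Set ℂ)) {a b : ℂ} (ha : ‖a‖ < 1) (hb : ‖b‖ < 1)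
    (hab : poincareDist a b < 1 / 4) :
    ‖f b - f a‖ ≤
      8 * Real.exp (Real.pi * (punctureHeight (f a) * Real.exp 1024)) * poincareDist a b := by
  obtain ⟨F, z, hF, hFm, h0, hz, hzle⟩ := exists_recentered hf hm ha hb
  set M := Real.exp (Real.pi * (punctureHeight (f a) * Real.exp 1024)) with hM
  have hpi := Real.pi_pos
  have hbound : ∀ x ∈ ball (0 : ℂ) (1 / 2), ‖F x‖ ≤ M := by
    intro x hx
    rw [mem_ball_zero_iff] at hx
    have h1 := punctureHeight_le_of_norm_le hF hFm hx.le
    rw [h0] at h1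
    have h2 : punctureHeight (F x) ≤ punctureHeight (f a) * Real.exp 1024 :=
      h1.trans (mul_le_mul_of_nonneg_left (Real.exp_le_exp.2 (by linarith))
        (punctureHeight_pos _).le)
    exact (norm_le_exp_punctureHeight _).trans (Real.exp_le_exp.2 (by gcongr))
  have hmaps : MapsTo F (ball 0 (1 / 2)) (closedBall (F 0) (2 * M)) := by
    intro x hx
    rw [mem_closedBall, dist_eq_norm]
    linarith [norm_sub_le (F x) (F 0), hbound x hx, hbound 0 (mem_ball_self (by norm_num))]
  have h := Complex.dist_le_div_mul_dist_of_mapsTo_ball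
    (hF.mono (ball_subset_ball (by norm_num))) hmaps
    (mem_ball_zero_iff.2 (by linarith : ‖z‖ < 1 / 2))
  rw [h0, hz, dist_eq_norm, dist_zero_right] at h
  have hM0 : 0 < M := Real.exp_pos _
  calc ‖f b - f a‖ ≤ 2 * M / (1 / 2) * ‖z‖ := h
    _ ≤ 2 * M / (1 / 2) * (2 * poincareDist a b) := by gcongr
    _ = 8 * M * poincareDist a b := by ring

/-- Exponential factors multiply along the chain as lengths add. One factor exp 1024 bounds the
height at the chain's vertices (4096 · 1/4 = 1024), the other inside each half disk. -/
theorem punctureHeight_le_and_norm_sub_le_of_mem_kobayashiChainLengths {p q : ℂ} {s : ℝ}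
    (hs : s ∈ kobayashiChainLengths ({0, 1}ᶜ : Set ℂ) p q) (hs4 : s < 1 / 4) :
    punctureHeight q ≤ punctureHeight p * Real.exp (4096 * s) ∧
    ‖q - p‖ ≤ 8 * Real.exp (Real.pi * (punctureHeight p * Real.exp 1024 * Real.exp 1024)) * s := by
  obtain ⟨k, x, a, b, f, hk, rfl, rfl, h, rfl⟩ := hs
  have hpi := Real.pi_pos
  have hh := punctureHeight_pos (x 0)
  have hω : ∀ i ∈ Finset.range k, 0 ≤ poincareDist (a i) (b i) := fun i hi => by
    obtain ⟨h1, h2, -⟩ := h i (Finset.mem_range.1 hi)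
    exact poincareDist_nonneg (mem_ball_zero_iff.1 h1) (mem_ball_zero_iff.1 h2)
  have key : ∀ j ≤ k,
      punctureHeight (x j) ≤ punctureHeight (x 0) *
        Real.exp (4096 * ∑ i ∈ Finset.range j, poincareDist (a i) (b i)) ∧
      ‖x j - x 0‖ ≤
        8 * Real.exp (Real.pi * (punctureHeight (x 0) * Real.exp 1024 * Real.exp 1024)) *
          ∑ i ∈ Finset.range j, poincareDist (a i) (b i) := by
    intro j
    induction j with
    | zero => simp
    | succ j ih =>
      intro hj
      obtain ⟨ih1, ih2⟩ := ih (by omega)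
      obtain ⟨ha, hb, hf, hm, hfa, hfb⟩ := h j (by omega)
      rw [mem_ball_zero_iff] at ha hb
      have hle : ∑ i ∈ Finset.range (j + 1), poincareDist (a i) (b i) ≤
          ∑ i ∈ Finset.range k, poincareDist (a i) (b i) :=
        Finset.sum_le_sum_of_subset_of_nonneg (Finset.range_subset_range.2 hj)
          fun i hi _ => hω i hi
      have hS : 0 ≤ ∑ i ∈ Finset.range j, poincareDist (a i) (b i) :=
        Finset.sum_nonneg fun i hi => hω i (Finset.mem_range.2
          ((Finset.mem_range.1 hi).trans (by omega)))
      have hωj := hω j (Finset.mem_range.2 (by omega))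
      rw [Finset.sum_range_succ] at hle ⊢
      set S := ∑ i ∈ Finset.range j, poincareDist (a i) (b i)
      have h1 := punctureHeight_le_of_poincareDist_lt hf hm ha hb (by linarith)
      have h2 := norm_sub_le_of_poincareDist_lt hf hm ha hb (by linarith)
      rw [hfa, hfb] at h1 h2
      constructor
      · rw [mul_add, Real.exp_add, ← mul_assoc]
        exact h1.trans (by gcongr)
      · have h3 : punctureHeight (x j) ≤ punctureHeight (x 0) * Real.exp 1024 :=
          ih1.trans (mul_le_mul_of_nonneg_left (Real.exp_le_exp.2 (by linarith)) hh.le)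
        have h4 := norm_add_le (x (j + 1) - x j) (x j - x 0)
        rw [sub_add_sub_cancel] at h4
        rw [mul_add]
        have h5 : 8 * Real.exp (Real.pi * (punctureHeight (x j) * Real.exp 1024)) *
            poincareDist (a j) (b j) ≤
            8 * Real.exp (Real.pi * (punctureHeight (x 0) * Real.exp 1024 * Real.exp 1024)) *
            poincareDist (a j) (b j) := by gcongr
        linarith
  exact key k le_rfl

/-! ### Separation of points and completeness -/

theorem eq_of_kobayashiDist_eq_zero {p q : ℂ} (h : kobayashiDist ({0, 1}ᶜ : Set ℂ) p q = 0) :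
    p = q := by
  set L := 8 * Real.exp (Real.pi * (punctureHeight p * Real.exp 1024 * Real.exp 1024)) with hL
  have hL0 : 0 < L := by positivity
  by_contra hne
  have hpos : 0 < ‖q - p‖ := norm_pos_iff.2 (sub_ne_zero.2 (Ne.symm hne))
  obtain ⟨s, hs, hlt⟩ := exists_mem_kobayashiChainLengths_lt
    (r := min (1 / 4) (‖q - p‖ / L)) (h.trans_lt (ENNReal.ofReal_pos.2 (by positivity)))
  have h1 := (punctureHeight_le_and_norm_sub_le_of_mem_kobayashiChainLengths hs
    (hlt.trans_le (min_le_left _ _))).2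
  have h2 := hlt.trans_le (min_le_right _ _)
  rw [lt_div_iff₀' hL0] at h2
  linarith

theorem theorem3p2 : IsCompleteKobayashiHyperbolic ({0, 1}ᶜ : Set ℂ) := by
  have hcount : ({0, 1} : Set ℂ).Countable := (Set.toFinite _).countable
  have hopen : IsOpen ({0, 1}ᶜ : Set ℂ) := (Set.toFinite _).isClosed.isOpen_compl
  have hconn : IsPreconnected ({0, 1}ᶜ : Set ℂ) :=
    (hcount.isConnected_compl_of_one_lt_rank (by simp)).isPreconnected
  have hfin : ∀ p q : ({0, 1}ᶜ : Set ℂ), kobayashiDist {0, 1}ᶜ (p : ℂ) q ≠ ⊤ :=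
    fun p q => (kobayashiDist_lt_top hopen hconn p.2 q.2).ne
  let m : MetricSpace ({0, 1}ᶜ : Set ℂ) :=
    { dist := fun p q => (kobayashiDist {0, 1}ᶜ (p : ℂ) q).toReal
      dist_self := fun p => by simp [kobayashiDist_self p.2]
      dist_comm := fun p q => by rw [kobayashiDist_comm]
      dist_triangle := fun p q r => by
        rw [← ENNReal.toReal_add (hfin p q) (hfin q r)]
        exact ENNReal.toReal_mono (ENNReal.add_ne_top.2 ⟨hfin p q, hfin q r⟩)
          (kobayashiDist_triangle _ _ _ _)
      eq_of_dist_eq_zero := fun {p q} h => Subtype.ext <| eq_of_kobayashiDist_eq_zero <|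
        ((ENNReal.toReal_eq_zero_iff _).1 h).resolve_right (hfin p q) }
  have hdist : ∀ p q : ({0, 1}ᶜ : Set ℂ),
      @dist _ m.toDist p q = (kobayashiDist {0, 1}ᶜ (p : ℂ) q).toReal := fun _ _ => rfl
  have hd : ∀ p q : ({0, 1}ᶜ : Set ℂ),
      kobayashiDist {0, 1}ᶜ (p : ℂ) q = ENNReal.ofReal (@dist _ m.toDist p q) :=
    fun p q => (ENNReal.ofReal_toReal (hfin p q)).symm
  refine ⟨m, hd, ?_⟩
  refine @Metric.complete_of_cauchySeq_tendsto _ m.toPseudoMetricSpace fun u hu => ?_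
  obtain ⟨N, hN⟩ := (@Metric.cauchySeq_iff' _ _ m.toPseudoMetricSpace _ _ _).1 hu (1 / 4)
    (by norm_num)
  obtain ⟨K, hK, hKD, hKmem⟩ := exists_isCompact_of_punctureHeight_le
    (punctureHeight (u N) * Real.exp 1024)
  -- The tail stays within 1/4 of `u N`, so its height grows by at most exp(4096/4).
  have huK : ∀ n, (u (N + n) : ℂ) ∈ K := by
    intro n
    refine hKmem _ (u (N + n)).2 ?_
    have h1 := hN (N + n) (by omega)
    rw [@dist_comm _ m.toPseudoMetricSpace] at h1
    obtain ⟨s, hs, hlt⟩ := exists_mem_kobayashiChainLengths_lt (r := 1 / 4)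
      ((hd (u N) (u (N + n))).trans_lt ((ENNReal.ofReal_lt_ofReal_iff (by norm_num)).2 h1))
    refine (punctureHeight_le_and_norm_sub_le_of_mem_kobayashiChainLengths hs hlt).1.trans
      (mul_le_mul_of_nonneg_left (Real.exp_le_exp.2 ?_) (punctureHeight_pos _).le)
    linarith
  obtain ⟨p, hpK, φ, hφ, hlim⟩ := hK.tendsto_subseq huK
  have hsub : Filter.Tendsto (fun n => N + φ n) Filter.atTop Filter.atTop :=
    Filter.tendsto_atTop_mono (fun n => Nat.le_add_left _ _) hφ.tendsto_atTop
  refine ⟨⟨p, hKD hpK⟩, @tendsto_nhds_of_cauchySeq_of_subseq _ _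
    m.toPseudoMetricSpace.toUniformSpace _ u hu _ _ Filter.atTop _ hsub _ ?_⟩
  rw [@tendsto_iff_dist_tendsto_zero _ _ m.toPseudoMetricSpace]
  -- The subsequence converges only in ℂ so far; continuity of the Kobayashi distance at p transfers
  -- this to the metric `m`.
  have h1 := (ENNReal.tendsto_toReal ENNReal.zero_ne_top).comp
    ((tendsto_kobayashiDist hopen (hKD hpK)).comp hlim)
  rw [ENNReal.toReal_zero] at h1
  refine h1.congr fun n => ?_
  rw [hdist, kobayashiDist_comm]
  rfl
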